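/- Fix a set of type constants $p$ and a set of constants $c$. The types and terms of the call-by-name $\lambda\Box$-calculus are $$\sigma ::= p \mid \sigma\supset\sigma \mid \Box\sigma,\qquad M ::= c^{\tau} \mid x \mid \lambda x^{\sigma}.M \mid MM \mid \mathrm{box}\ x_1^{\sigma_1},\ldots,x_n^{\sigma_n}\ \mathrm{be}\ M_1,\ldots,M_n\ \mathrm{in}\ M\quad(n\ge 0),$$ taken up to $\alpha$-equivalence; $\mathrm{box}\ \vec x\ \mathrm{be}\ \vec N\ \mathrm{in}\ M$ binds $\vec x$ in $M$, the free variables of $M$ are among $\vec x$, and its own free variables are those of $\vec N$. The typing rules are: $\Gamma\vdash c^\tau:\tau$; $\Gamma,x:\tau,\Gamma'\vdash x:\tau$; if $\Gamma,x:\sigma\vdash M:\tau$ then $\Gamma\vdash\lambda x^\sigma.M:\sigma\supset\tau$; if $\Gamma\vdash M:\sigma\supset\tau$ and $\Gamma\vdash N:\sigma$ then $\Gamma\vdash MN:\tau$; if $x_1:\sigma_1,\ldots,x_n:\sigma_n\vdash M:\tau$ and $\Gamma\vdash N_i:\Box\sigma_i$ for all $i$, then $\Gamma\vdash \mathrm{box}\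 x_1^{\sigma_1},\ldots,x_n^{\sigma_n}\ \mathrm{be}\ N_1,\ldots,N_n\ \mathrm{in}\ M:\Box\tau$. One-step reduction $\to$ is the closure under all term formers (including under $\lambda$, in the arguments of a box and in the body of a box) of the rules - $(\beta_\supset)$: $(\lambda x.M)N\to M[N/x]$; - $(\eta_\supset)$: $\lambda x.Mx\to M$ if $x$ is not free in $M$; - $(\mathrm{id}_\Box)$: $\mathrm{box}\ x\ \mathrm{be}\ M\ \mathrm{in}\ x\to M$; - $(\beta_\Box)$: $\mathrm{box}\ \vec w,x,\vec z\ \mathrm{be}\ \vec P,(\mathrm{box}\ \vec y\ \mathrm{be}\ \vec L\ \mathrm{in}\ N),\vec Q\ \mathrm{in}\ M\to \mathrm{box}\ \vec w,\vec y,\vec z\ \mathrm{be}\ \vec P,\vec L,\vec Q\ \mathrm{in}\ M[N/x]$, where $\vec w$ and $\vec P$ have the same length. Then the calculus is strongly normalizing: whenever $\Gamma\vdash M:\tau$ for some context $\Gamma$ and type $\tau$, there is no infinite reduction sequence $M\to M_1\to M_2\to\cdots$. -/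

import Mathlib

/-- Types `σ ::= p ∣ σ ⊃ σ ∣ □ σ`, with `p` ranging over a set `P` of type constants. -/
inductive Ty (P : Type*) where
  | base (p : P) : Ty P
  | imp (σ τ : Ty P) : Ty P
  | box (σ : Ty P) : Ty P

/-- Terms of the `λ□`-calculus up to `α`-equivalence: `Term P C n` is the set of terms whose free
variables are among `n` variables, numbered by `Fin n` (well-scoped de Bruijn terms).
`P` is the set of type constants and `C` the set of constants. The terms are not assumed to be
typable. -/
inductive Term (P C : Type*) : ℕ → Type _ where
  /-- The constant `c` with its type `τ`. -/
  | const {n : ℕ} (c : C) (τ : Ty P) : Term P C n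
  | var {n : ℕ} (x : Fin n) : Term P C n
  /-- `λ x^σ. M`; inside `M` the bound variable is `0` and an outer variable `i` is `i + 1`. -/
  | lam {n : ℕ} (σ : Ty P) (M : Term P C (n + 1)) : Term P C n
  | app {n : ℕ} (M N : Term P C n) : Term P C n
  /-- `box x₁^σ₁, …, xₖ^σₖ be N₁, …, Nₖ in M`, where `k` may be `0`. The variables of the body `M`
  are exactly `x₁, …, xₖ`, numbered by `Fin k`, so the free variables of the whole term are
  those of `N₁, …, Nₖ`. -/
  | box {n k : ℕ} (σ : Fin k → Ty P) (N : Fin k → Term P C n) (M : Term P C k) : Term P C n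

namespace Term

/-- Renaming of the free variables along `ρ`. -/
def rename {P C : Type*} : {n m : ℕ} → (Fin n → Fin m) → Term P C n → Term P C m
  | _, _, _, const c τ => const c τ
  | _, _, ρ, var x => var (ρ x)
  | _, m, ρ, lam σ M =>
      lam σ (M.rename (Fin.cons (α := fun _ => Fin (m + 1)) 0 (fun i => (ρ i).succ)))
  | _, _, ρ, app M N => app (M.rename ρ) (N.rename ρ)
  | _, _, ρ, box σ N M => box σ (fun i => (N i).rename ρ) M

/-- Simultaneous capture-avoiding substitution of `s i` for each free variable `i`. -/
def subst {P C : Type*} : {n m : ℕ} → (Fin n → Term P C m) → Term P C n → Term P C m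
  | _, _, _, const c τ => const c τ
  | _, _, s, var x => s x
  | _, m, s, lam σ M =>
      lam σ (M.subst (Fin.cons (α := fun _ => Term P C (m + 1)) (var 0)
        (fun i => (s i).rename Fin.succ)))
  | _, _, s, app M N => app (M.subst s) (N.subst s)
  | _, _, s, box σ N M => box σ (fun i => (N i).subst s) M

/-- `M[N/x]` where `x` is the variable `0` of `M`. -/
def inst {P C : Type*} {n : ℕ} (M : Term P C (n + 1)) (N : Term P C n) : Term P C n :=
  M.subst (Fin.cons (α := fun _ => Term P C n) N var)

/-- `M[N/x]` for a term `M` in the variables `w, x, z` and a term `N` in the variables `y`,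
where `w`, `y`, `z` have lengths `a`, `c`, `b`; the result has the variables `w, y, z`. -/
def instMid {P C : Type*} {a b c : ℕ} (M : Term P C (a + 1 + b)) (N : Term P C c) :
    Term P C (a + c + b) :=
  M.subst (Fin.append
    (Fin.snoc (α := fun _ => Term P C (a + c + b))
      (fun i : Fin a => var (Fin.castAdd b (Fin.castAdd c i)))
      (N.rename (fun j : Fin c => Fin.castAdd b (Fin.natAdd a j))))
    (fun i : Fin b => var (Fin.natAdd (a + c) i)))

end Term

/-- The typing judgement `Γ ⊢ M : τ`, for a context `Γ` that gives a type to each of the `n`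
variables. -/
inductive HasType {P C : Type*} : {n : ℕ} → (Fin n → Ty P) → Term P C n → Ty P → Prop
  | const {n : ℕ} {Γ : Fin n → Ty P} (c : C) (τ : Ty P) : HasType Γ (.const c τ) τ
  | var {n : ℕ} {Γ : Fin n → Ty P} (x : Fin n) : HasType Γ (.var x) (Γ x)
  | lam {n : ℕ} {Γ : Fin n → Ty P} {σ τ : Ty P} {M : Term P C (n + 1)} :
      HasType (Fin.cons (α := fun _ => Ty P) σ Γ) M τ → HasType Γ (.lam σ M) (.imp σ τ)
  | app {n : ℕ} {Γ : Fin n → Ty P} {σ τ : Ty P} {M N : Term P C n} :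
      HasType Γ M (.imp σ τ) → HasType Γ N σ → HasType Γ (.app M N) τ
  | box {n k : ℕ} {Γ : Fin n → Ty P} {σ : Fin k → Ty P} {τ : Ty P}
      {N : Fin k → Term P C n} {M : Term P C k} :
      HasType σ M τ → (∀ i, HasType Γ (N i) (.box (σ i))) →
      HasType Γ (.box σ N M) (.box τ)

/-- The labels of the call-by-name reduction rules: `β⊃`, `η⊃`, `id□`, `β□`. -/
inductive RuleLabel where
  | betaImp
  | etaImp
  | idBox
  | betaBox

/-- The call-by-name reduction rules, applied at the root of a term. -/
inductive RootStep {P C : Type*} : RuleLabel → {n : ℕ} → Term P C n → Term P C n → Prop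
  /-- `(λ x. M) N → M[N/x]`. -/
  | betaImp {n : ℕ} (σ : Ty P) (M : Term P C (n + 1)) (N : Term P C n) :
      RootStep .betaImp (.app (.lam σ M) N) (M.inst N)
  /-- `λ x. M x → M` if `x` is not free in `M`. -/
  | etaImp {n : ℕ} (σ : Ty P) (M : Term P C n) :
      RootStep .etaImp (.lam σ (.app (M.rename Fin.succ) (.var 0))) M
  /-- `box x be M in x → M`. -/
  | idBox {n : ℕ} (σ : Ty P) (M : Term P C n) :
      RootStep .idBox (.box (k := 1) (fun _ => σ) (fun _ => M) (.var 0)) M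
  /-- `box w, x, z be P, (box y be L in N), Q in M → box w, y, z be P, L, Q in M[N/x]`,
  where `w` and `P` have the same length; here `ρ, θ, ζ, η` are the type annotations of
  `w, x, z, y`, in this order. -/
  | betaBox {n a b c : ℕ} (ρ : Fin a → Ty P) (θ : Ty P) (ζ : Fin b → Ty P) (η : Fin c → Ty P)
      (A : Fin a → Term P C n) (Q : Fin b → Term P C n) (L : Fin c → Term P C n)
      (N : Term P C c) (M : Term P C (a + 1 + b)) :
      RootStep .betaBox
        (.box (Fin.append (Fin.snoc (α := fun _ => Ty P) ρ θ) ζ)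
          (Fin.append (Fin.snoc (α := fun _ => Term P C n) A (.box η L N)) Q) M)
        (.box (Fin.append (Fin.append ρ η) ζ) (Fin.append (Fin.append A L) Q) (M.instMid N))

/-- One-step reduction by the rules whose label is in `X`, applied to any subterm (also under `λ`,
in the arguments of a box and in the body of a box). -/
inductive Step {P C : Type*} (X : Set RuleLabel) : {n : ℕ} → Term P C n → Term P C n → Prop
  | root {n : ℕ} {r : RuleLabel} {M N : Term P C n} : r ∈ X → RootStep r M N → Step X M N
  | lam {n : ℕ} {σ : Ty P} {M M' : Term P C (n + 1)} :
      Step X M M' → Step X (.lam σ M) (.lam σ M')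
  | appLeft {n : ℕ} {M M' N : Term P C n} : Step X M M' → Step X (.app M N) (.app M' N)
  | appRight {n : ℕ} {M N N' : Term P C n} : Step X N N' → Step X (.app M N) (.app M N')
  | boxArg {n k : ℕ} {σ : Fin k → Ty P} {N : Fin k → Term P C n} {M : Term P C k}
      (i : Fin k) {N' : Term P C n} :
      Step X (N i) N' → Step X (.box σ N M) (.box σ (Function.update N i N') M)
  | boxBody {n k : ℕ} {σ : Fin k → Ty P} {N : Fin k → Term P C n} {M M' : Term P C k} :
      Step X M M' → Step X (.box σ N M) (.box σ N M')

/-- The call-by-name rule set `{β⊃, η⊃, id□, β□}`. -/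
def cbnRules : Set RuleLabel :=
  {RuleLabel.betaImp, RuleLabel.etaImp, RuleLabel.idBox, RuleLabel.betaBox}

/-- `M` is strongly normalizing for the rules in `X`: the converse of the one-step reduction is
well-founded below `M`, that is, there is no infinite reduction sequence from `M`. -/
def StronglyNormalizing {P C : Type*} (X : Set RuleLabel) {n : ℕ} (M : Term P C n) : Prop :=
  Acc (fun N' N : Term P C n => Step X N N') M

/-! The proof is by reducibility in the style of Tait. All terms are interpreted over a single
variable, reducible at every type because it is neutral; no typing is imposed on reducible terms, so
sending all variables to this one is harmless, and `StronglyNormalizing.of_subst` reflects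
normalization back.

The delicate clause is the one for `□τ`. Since β□ merges a nested box into the outer body, a term is
reducible at `□τ` if it is strongly normalizing and every body obtainable from it by reducing and
merging (`BoxBody`) is reducible at `τ`. Variables left unmerged become the single variable, which
avoids tracking their number.

`Reducible.box` carries the argument: β□ replaces one argument by the arguments of that box, so the
multiset of arguments decreases for "reduct or box argument", while the set of obtainable bodies
does not grow. With `Reducible.lam`, this gives the fundamental lemma `HasType.reducible`. -/

namespace Term

variable {P C : Type*}

/-! ### Algebra of renaming and substitution -/

theorem rename_rename {n : ℕ} (M : Term P C n) : ∀ {m k : ℕ} (ρ : Fin n → Fin m)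
    (ρ' : Fin m → Fin k), (M.rename ρ).rename ρ' = M.rename (ρ' ∘ ρ) := by
  induction M with
  | const c τ => intros; rfl
  | var x => intros; rfl
  | lam σ M ih =>
    intro m k ρ ρ'
    simp only [rename, ih]
    congr 2
    funext i
    cases i using Fin.cases <;> simp
  | app M N ihM ihN => intros; simp only [rename, ihM, ihN]
  | box σ N M ihN ihM => intros; simp only [rename, ihN]

theorem subst_rename {n : ℕ} (M : Term P C n) : ∀ {m k : ℕ} (ρ : Fin n → Fin m)
    (s : Fin m → Term P C k), (M.rename ρ).subst s = M.subst (s ∘ ρ) := by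
  induction M with
  | const c τ => intros; rfl
  | var x => intros; rfl
  | lam σ M ih =>
    intro m k ρ s
    simp only [rename, subst, ih]
    congr 2
    funext i
    cases i using Fin.cases <;> simp
  | app M N ihM ihN => intros; simp only [rename, subst, ihM, ihN]
  | box σ N M ihN ihM => intros; simp only [rename, subst, ihN]

theorem rename_subst {n : ℕ} (M : Term P C n) : ∀ {m k : ℕ} (s : Fin n → Term P C m)
    (ρ : Fin m → Fin k), (M.subst s).rename ρ = M.subst (fun i => (s i).rename ρ) := by
  induction M with
  | const c τ => intros; rfl
  | var x => intros; rfl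
  | lam σ M ih =>
    intro m k s ρ
    simp only [rename, subst, ih]
    congr 2
    funext i
    cases i using Fin.cases
    · simp [rename]
    · simp only [Fin.cons_succ, rename_rename]
      congr 1
  | app M N ihM ihN => intros; simp only [rename, subst, ihM, ihN]
  | box σ N M ihN ihM => intros; simp only [rename, subst, ihN]

theorem subst_subst {n : ℕ} (M : Term P C n) : ∀ {m k : ℕ} (s : Fin n → Term P C m)
    (t : Fin m → Term P C k), (M.subst s).subst t = M.subst (fun i => (s i).subst t) := by
  induction M with
  | const c τ => intros; rfl
  | var x => intros; rfl
  | lam σ M ih =>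
    intro m k s t
    simp only [subst, ih]
    congr 2
    funext i
    cases i using Fin.cases
    · simp [subst]
    · simp only [Fin.cons_succ, subst_rename, rename_subst]
      congr 1
  | app M N ihM ihN => intros; simp only [subst, ihM, ihN]
  | box σ N M ihN ihM => intros; simp only [subst, ihN]

theorem subst_var {n : ℕ} (M : Term P C n) : M.subst var = M := by
  induction M with
  | const c τ => rfl
  | var x => rfl
  | @lam n σ M ih =>
    have h : (Fin.cons (α := fun _ => Term P C (n + 1)) (var 0)
        fun i : Fin n => (var i).rename Fin.succ) = var := by
      funext i
      cases i using Fin.cases <;> rfl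
    simp only [subst]
    rw [h, ih]
  | app M N ihM ihN => simp only [subst, ihM, ihN]
  | box σ N M ihN ihM => simp only [subst, ihN]

theorem inst_rename_succ {n : ℕ} (M N : Term P C n) : (M.rename Fin.succ).inst N = M := by
  rw [inst, subst_rename]
  exact subst_var M

theorem inst_subst_lift {n m : ℕ} (M : Term P C (n + 1)) (s : Fin n → Term P C m)
    (N : Term P C m) :
    (M.subst (Fin.cons (α := fun _ => Term P C (m + 1)) (var 0)
      (fun i => (s i).rename Fin.succ))).inst N =
      M.subst (Fin.cons (α := fun _ => Term P C m) N s) := by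
  rw [inst, subst_subst]
  congr 1
  funext i
  cases i using Fin.cases
  · rfl
  · exact inst_rename_succ _ _

theorem inst_subst {n m : ℕ} (M : Term P C (n + 1)) (N : Term P C n) (s : Fin n → Term P C m) :
    (M.inst N).subst s =
      (M.subst (Fin.cons (α := fun _ => Term P C (m + 1)) (var 0)
        (fun i => (s i).rename Fin.succ))).inst (N.subst s) := by
  rw [inst_subst_lift, inst, subst_subst]
  congr 1
  funext i
  cases i using Fin.cases <;> rfl

/-- In the β□ case this exhibits an instance of the merged body as an instance of the outer body,
with the inner box contributing its own instantiated body. -/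
theorem instMid_subst {a b c m : ℕ} (M : Term P C (a + 1 + b)) (N : Term P C c)
    (K : Fin (a + c + b) → Term P C m) :
    (M.instMid N).subst K =
      M.subst (Fin.append
        (Fin.snoc (α := fun _ => Term P C m) (fun i : Fin a => K (Fin.castAdd b (Fin.castAdd c i)))
          (N.subst fun j => K (Fin.castAdd b (Fin.natAdd a j))))
        (fun i : Fin b => K (Fin.natAdd (a + c) i))) := by
  rw [instMid, subst_subst]
  congr 1
  funext i
  cases i using Fin.addCases with
  | left i =>
    cases i using Fin.lastCases with
    | last => simp [subst_rename, Function.comp_def]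
    | cast i => simp [subst]
  | right i => simp [subst]

end Term

section Reducibility

open Term

variable {P C : Type*}

/-! ### Stability of reduction under substitution -/

theorem Fin.comp_append_snoc {a b : ℕ} {α β : Type*} (f : α → β) (A : Fin a → α) (x : α)
    (Q : Fin b → α) :
    (fun i => f (Fin.append (Fin.snoc (α := fun _ => α) A x) Q i)) =
      Fin.append (Fin.snoc (α := fun _ => β) (fun i => f (A i)) (f x)) (fun i => f (Q i)) := by
  funext i
  cases i using Fin.addCases with
  | left i => cases i using Fin.lastCases <;> simp
  | right i => simp

theorem Fin.comp_append_append {a b c : ℕ} {α β : Type*} (f : α → β) (A : Fin a → α)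
    (L : Fin c → α) (Q : Fin b → α) :
    (fun i => f (Fin.append (Fin.append A L) Q i)) =
      Fin.append (Fin.append (fun i => f (A i)) (fun i => f (L i))) (fun i => f (Q i)) := by
  funext i
  cases i using Fin.addCases with
  | left i => cases i using Fin.addCases <;> simp
  | right i => simp

theorem RootStep.subst {r : RuleLabel} {n : ℕ} {M M' : Term P C n} (h : RootStep r M M') {m : ℕ}
    (s : Fin n → Term P C m) : RootStep r (M.subst s) (M'.subst s) := by
  cases h with
  | betaImp σ M N =>
    rw [inst_subst]
    exact .betaImp _ _ _
  | etaImp σ =>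
    have h := RootStep.etaImp σ (M'.subst s)
    rw [rename_subst] at h
    simp only [Term.subst, subst_rename]
    exact h
  | idBox σ => exact .idBox σ _
  | betaBox ρ θ ζ η A Q L N M =>
    simp only [Term.subst]
    rw [Fin.comp_append_snoc (fun T : Term P C n => T.subst s),
      Fin.comp_append_append (fun T : Term P C n => T.subst s)]
    exact .betaBox ρ θ ζ η _ _ _ _ _

theorem Step.subst {X : Set RuleLabel} {n : ℕ} {M M' : Term P C n} (h : Step X M M') :
    ∀ {m : ℕ} (s : Fin n → Term P C m), Step X (M.subst s) (M'.subst s) := by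
  induction h with
  | root hr h => exact fun s => .root hr (h.subst s)
  | lam _ ih => exact fun s => .lam (ih _)
  | appLeft _ ih => exact fun s => .appLeft (ih s)
  | appRight _ ih => exact fun s => .appRight (ih s)
  | @boxArg n k σ N M i N' _ ih =>
    intro m s
    have h := Step.boxArg (σ := σ) (N := fun j => (N j).subst s) (M := M) i (ih s)
    simp only [Term.subst]
    convert h using 2
    funext j
    rcases eq_or_ne j i with rfl | hj
    · simp
    · simp [hj]
  | boxBody h _ => exact fun s => .boxBody h

/-- A proof of strong normalization may be pulled back along a map that preserves steps. -/
theorem StronglyNormalizing.of_map {X : Set RuleLabel} {n m : ℕ} (f : Term P C n → Term P C m)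
    (hf : ∀ {M M'}, Step X M M' → Step X (f M) (f M')) {M : Term P C n}
    (h : StronglyNormalizing X (f M)) : StronglyNormalizing X M :=
  Subrelation.accessible (fun h => hf h) (InvImage.accessible f h)

theorem StronglyNormalizing.of_subst {X : Set RuleLabel} {n m : ℕ} {s : Fin n → Term P C m}
    {M : Term P C n} (h : StronglyNormalizing X (M.subst s)) : StronglyNormalizing X M :=
  h.of_map (fun M => M.subst s) fun h => h.subst s

/-! ### Reducibility and abstractions -/

/-- `BoxBody M K`: after reducing `M` and merging boxes nested in its arguments, `K` is the body
of a resulting box, with the remaining variables identified. -/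
inductive BoxBody : Term P C 1 → Term P C 1 → Prop
  | var (M : Term P C 1) : BoxBody M (.var 0)
  | step {M M' K : Term P C 1} : Step cbnRules M M' → BoxBody M' K → BoxBody M K
  | box {k : ℕ} (σ : Fin k → Ty P) {N K : Fin k → Term P C 1} (M : Term P C k) :
      (∀ i, BoxBody (N i) (K i)) → BoxBody (.box σ N M) (M.subst K)

/-- Reducibility of terms in one variable. -/
def Reducible : Ty P → Term P C 1 → Prop
  | .base _, M => StronglyNormalizing cbnRules M
  | .imp σ τ, M => ∀ N, Reducible σ N → Reducible τ (.app M N)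
  | .box τ, M => StronglyNormalizing cbnRules M ∧ ∀ K, BoxBody M K → Reducible τ K

/-- A term that is neither an abstraction nor a box. -/
def Term.IsNeutral {n : ℕ} : Term P C n → Prop
  | .lam _ _ => False
  | .box _ _ _ => False
  | _ => True

theorem Reducible.step {τ : Ty P} : ∀ {M M' : Term P C 1}, Reducible τ M → Step cbnRules M M' →
    Reducible τ M' := by
  induction τ with
  | base p => exact fun h hs => h.inv hs
  | imp σ τ _ ih => exact fun h hs N hN => ih (h N hN) (.appLeft hs)
  | box τ _ => exact fun h hs => ⟨h.1.inv hs, fun K hK => h.2 K (.step hs hK)⟩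

theorem Step.app_cases {X : Set RuleLabel} {n : ℕ} {M N T : Term P C n}
    (h : Step X (.app M N) T) :
    (∃ σ M₀, M = .lam σ M₀ ∧ T = M₀.inst N) ∨ (∃ M', Step X M M' ∧ T = .app M' N) ∨
      ∃ N', Step X N N' ∧ T = .app M N' := by
  cases h with
  | root _ h =>
    cases h with
    | betaImp σ M N => exact .inl ⟨σ, M, rfl, rfl⟩
  | appLeft h => exact .inr (.inl ⟨_, h, rfl⟩)
  | appRight h => exact .inr (.inr ⟨_, h, rfl⟩)

theorem Step.lam_cases {X : Set RuleLabel} {n : ℕ} {σ : Ty P} {M : Term P C (n + 1)}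
    {T : Term P C n} (h : Step X (.lam σ M) T) :
    M = .app (T.rename Fin.succ) (.var 0) ∨ ∃ M', Step X M M' ∧ T = .lam σ M' := by
  cases h with
  | root _ h =>
    cases h with
    | etaImp => exact .inl rfl
  | lam h => exact .inr ⟨_, h, rfl⟩

theorem not_step_var {X : Set RuleLabel} {n : ℕ} {x : Fin n} {T : Term P C n} :
    ¬ Step X (.var x) T := by
  intro h
  cases h with
  | root _ h => cases h

theorem not_step_const {X : Set RuleLabel} {n : ℕ} {c : C} {σ : Ty P} {T : Term P C n} :
    ¬ Step X (.const c σ) T := by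
  intro h
  cases h with
  | root _ h => cases h

/-- The two halves need a joint induction: normalization at `σ ⊃ τ` applies the term to a variable,
reducible by the neutral half at `σ`, and the neutral half inducts on normalization of the argument.
-/
theorem Reducible.sn_and_of_neutral (τ : Ty P) :
    (∀ M : Term P C 1, Reducible τ M → StronglyNormalizing cbnRules M) ∧
      ∀ M : Term P C 1, M.IsNeutral → (∀ M', Step cbnRules M M' → Reducible τ M') →
        Reducible τ M := by
  induction τ with
  | base p => exact ⟨fun _ h => h, fun M _ h => ⟨_, h⟩⟩
  | imp σ τ ihσ ihτ =>
    refine ⟨fun M h => ?_, fun M hM h N hN => ?_⟩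
    · have hv : Reducible σ (.var 0 : Term P C 1) :=
        ihσ.2 _ trivial fun _ hs => (not_step_var hs).elim
      exact StronglyNormalizing.of_map (fun M => .app M (.var 0)) (fun h => .appLeft h)
        (ihτ.1 _ (h _ hv))
    · have hacc := ihσ.1 N hN
      induction hacc with
      | intro N _ ih =>
        refine ihτ.2 _ trivial fun T hT => ?_
        rcases hT.app_cases with ⟨_, _, rfl, _⟩ | ⟨M', hs, rfl⟩ | ⟨N', hs, rfl⟩
        · exact hM.elim
        · exact h _ hs _ hN
        · exact ih _ hs (hN.step hs)
  | box τ ih =>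
    refine ⟨fun _ h => h.1, fun M hM h => ⟨⟨_, fun M' hs => (h M' hs).1⟩, fun K hK => ?_⟩⟩
    cases hK with
    | var => exact ih.2 _ trivial fun _ hs => (not_step_var hs).elim
    | step hs hK => exact (h _ hs).2 _ hK
    | box => exact hM.elim

theorem Reducible.sn {τ : Ty P} {M : Term P C 1} (h : Reducible τ M) :
    StronglyNormalizing cbnRules M :=
  (sn_and_of_neutral τ).1 M h

theorem Reducible.of_neutral {τ : Ty P} {M : Term P C 1} (hM : M.IsNeutral)
    (h : ∀ M', Step cbnRules M M' → Reducible τ M') : Reducible τ M :=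
  (sn_and_of_neutral τ).2 M hM h

theorem Reducible.var (τ : Ty P) : Reducible τ (.var 0 : Term P C 1) :=
  .of_neutral trivial fun _ hs => (not_step_var hs).elim

theorem Reducible.const (c : C) (σ τ : Ty P) : Reducible τ (.const c σ : Term P C 1) :=
  .of_neutral trivial fun _ hs => (not_step_const hs).elim

theorem Reducible.lam {σ' σ τ : Ty P} {M : Term P C 2}
    (h : ∀ N, Reducible σ N → Reducible τ (M.inst N)) : Reducible (.imp σ τ) (.lam σ' M) := by
  intro N hN
  have hM : StronglyNormalizing cbnRules M := (h _ (.var σ)).sn.of_subst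
  induction hM generalizing N with
  | intro M _ ihM =>
    have hN' := hN.sn
    induction hN' with
    | intro N _ ihN =>
      refine .of_neutral trivial fun T hT => ?_
      rcases hT.app_cases with ⟨_, M₀, he, rfl⟩ | ⟨L, hs, rfl⟩ | ⟨N', hs, rfl⟩
      · cases he
        exact h N hN
      · rcases hs.lam_cases with rfl | ⟨M', hM', rfl⟩
        -- An η-step of the abstraction gives `L N`, which is exactly the β-contractum.
        · have := h N hN
          rwa [show (Term.app (L.rename Fin.succ) (.var 0)).inst N =
            .app ((L.rename Fin.succ).inst N) N from rfl, inst_rename_succ] at this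
        · exact ihM M' hM' (fun N hN => (h N hN).step (hM'.subst _)) N hN
      · exact ihN N' hs (hN.step hs)

/-! ### Well-founded descent on box arguments -/

/-- `BoxArgStep M' M`: `M` reduces to `M'`, or `M` is a box that has `M'` as an argument. -/
inductive BoxArgStep {n : ℕ} : Term P C n → Term P C n → Prop
  | step {M M' : Term P C n} : Step cbnRules M M' → BoxArgStep M' M
  | arg {k : ℕ} (σ : Fin k → Ty P) (N : Fin k → Term P C n) (M : Term P C k) (i : Fin k) :
      BoxArgStep (N i) (.box σ N M)

theorem acc_boxArgStep_of_step {n : ℕ} (M : Term P C n)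
    (h : ∀ M', Step cbnRules M M' → Acc BoxArgStep M') : Acc BoxArgStep M := by
  induction M with
  | box σ N M ihN _ =>
    refine ⟨_, fun T hT => ?_⟩
    cases hT with
    | step hs => exact h _ hs
    | arg _ _ _ i =>
      -- A step inside an argument lifts to the whole box, whose reduct is accessible and has the
      -- reduced argument below it.
      refine ihN i fun L hL => (h _ (.boxArg i hL)).inv ?_
      have := BoxArgStep.arg σ (Function.update N i L) M i
      rwa [Function.update_self] at this
  | _ => exact ⟨_, fun T hT => by cases hT with | step hs => exact h _ hs⟩

theorem StronglyNormalizing.acc_boxArgStep {n : ℕ} {M : Term P C n}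
    (h : StronglyNormalizing cbnRules M) : Acc BoxArgStep M := by
  induction h with
  | intro M _ ih => exact acc_boxArgStep_of_step M ih

/-- `BoxArgStep` on accessible terms. -/
def AccBoxArgStep {n : ℕ} (M' M : Term P C n) : Prop :=
  Acc BoxArgStep M ∧ BoxArgStep M' M

/-- Required by `Acc.cutExpand`. Without the accessibility restriction it fails: an untyped term may
reduce to itself. -/
instance {n : ℕ} : Std.Irrefl (AccBoxArgStep (P := P) (C := C) (n := n)) where
  irrefl M h := by
    obtain ⟨h, hM⟩ := h
    induction h with
    | intro M _ ih => exact ih M hM hM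

theorem acc_cutExpand_boxArgs {n k : ℕ} (N : Fin k → Term P C n)
    (h : ∀ i, StronglyNormalizing cbnRules (N i)) :
    Acc (Relation.CutExpand AccBoxArgStep) (∑ i, ({N i} : Multiset (Term P C n))) := by
  refine Relation.acc_of_singleton fun M hM => Acc.cutExpand ?_
  obtain ⟨i, _, hi⟩ := Multiset.mem_sum.1 hM
  rw [Multiset.mem_singleton.1 hi]
  exact Subrelation.accessible (fun h => h.2) (h i).acc_boxArgStep

theorem cutExpand_update {n k : ℕ} {N : Fin k → Term P C n} {i : Fin k} {N' : Term P C n}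
    (hi : StronglyNormalizing cbnRules (N i)) (h : Step cbnRules (N i) N') :
    Relation.CutExpand AccBoxArgStep
      (∑ j, ({Function.update N i N' j} : Multiset (Term P C n))) (∑ j, {N j}) := by
  refine ⟨{N'}, N i, fun T hT => ?_, ?_⟩
  · rw [Multiset.mem_singleton.1 hT]
    exact ⟨hi.acc_boxArgStep, .step h⟩
  · rw [← Finset.add_sum_erase _ _ (Finset.mem_univ i),
      ← Finset.add_sum_erase _ (fun j => ({N j} : Multiset _)) (Finset.mem_univ i),
      Finset.sum_congr rfl (g := fun j => ({N j} : Multiset _)), Function.update_self]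
    · abel
    · intro j hj
      rw [Function.update_of_ne (Finset.ne_of_mem_erase hj)]

theorem cutExpand_append {n a b c : ℕ} (A : Fin a → Term P C n) (Q : Fin b → Term P C n)
    (η : Fin c → Ty P) (L : Fin c → Term P C n) (N : Term P C c)
    (h : StronglyNormalizing cbnRules (.box η L N)) :
    Relation.CutExpand AccBoxArgStep
      (∑ i, ({Fin.append (Fin.append A L) Q i} : Multiset (Term P C n)))
      (∑ i, {Fin.append (Fin.snoc (α := fun _ => Term P C n) A (.box η L N)) Q i}) := by
  refine ⟨∑ j, {L j}, .box η L N, fun T hT => ?_, ?_⟩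
  · obtain ⟨j, _, hj⟩ := Multiset.mem_sum.1 hT
    rw [Multiset.mem_singleton.1 hj]
    exact ⟨h.acc_boxArgStep, .arg _ _ _ j⟩
  · simp only [Fin.sum_univ_add, Fin.sum_univ_castSucc, Fin.append_left, Fin.append_right,
      Fin.snoc_castSucc, Fin.snoc_last]
    abel

/-! ### Reducibility of boxes and the fundamental lemma -/

theorem StronglyNormalizing.boxArg {n k : ℕ} {σ : Fin k → Ty P} {N : Fin k → Term P C n}
    {M : Term P C k} (h : StronglyNormalizing cbnRules (.box σ N M)) (i : Fin k) :
    StronglyNormalizing cbnRules (N i) := by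
  refine StronglyNormalizing.of_map (fun T => .box σ (Function.update N i T) M) (fun {T T'} hs => ?_)
    (by rwa [Function.update_eq_self])
  have := Step.boxArg (σ := σ) (N := Function.update N i T) (M := M) i (N' := T')
    (by rwa [Function.update_self])
  rwa [Function.update_idem] at this

/-- Lexicographic induction: first the multiset of arguments under `CutExpand`, then normalization
of the body. The length `k` varies, as β□ changes it. -/
theorem Reducible.box {τ : Ty P} {k : ℕ} {σ : Fin k → Ty P} {N : Fin k → Term P C 1}
    {M : Term P C k} (hN : ∀ i, StronglyNormalizing cbnRules (N i))
    (h : ∀ K : Fin k → Term P C 1, (∀ i, BoxBody (N i) (K i)) → Reducible τ (M.subst K)) :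
    Reducible (.box τ) (.box σ N M) := by
  obtain ⟨S, hS⟩ : ∃ S, S = ∑ i, ({N i} : Multiset (Term P C 1)) := ⟨_, rfl⟩
  have hacc := acc_cutExpand_boxArgs N hN
  rw [← hS] at hacc
  induction hacc generalizing k with
  | intro S _ ihS =>
    subst hS
    have hM : StronglyNormalizing cbnRules M := (h (fun _ => .var 0) fun i => .var _).sn.of_subst
    induction hM with
    | intro M _ ihM =>
      have key : ∀ T, Step cbnRules (.box σ N M) T → Reducible (.box τ) T := by
        intro T hT
        cases hT with
        | root _ hr =>
          cases hr with
          -- The body is the variable, so its instances are precisely the bodies of the argument.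
          | idBox σ => exact ⟨hN 0, fun K hK => h (fun _ => K) fun _ => hK⟩
          | @betaBox _ a b c ρ θ ζ η A Q L N M =>
            have hA : ∀ i, StronglyNormalizing cbnRules (A i) := fun i => by
              simpa using hN (Fin.castAdd b (Fin.castSucc i))
            have hB : StronglyNormalizing cbnRules (.box η L N) := by
              simpa using hN (Fin.castAdd _ (Fin.last _))
            have hQ : ∀ i, StronglyNormalizing cbnRules (Q i) := fun i => by
              simpa using hN (Fin.natAdd _ i)
            refine ihS _ (cutExpand_append A Q η L N hB) ?_ ?_ rfl
            · intro i
              cases i using Fin.addCases with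
              | left i =>
                cases i using Fin.addCases with
                | left i => simpa using hA i
                | right i => simpa using hB.boxArg i
              | right i => simpa using hQ i
            · intro K hK
              rw [instMid_subst]
              refine h _ fun i => ?_
              cases i using Fin.addCases with
              | left i =>
                cases i using Fin.lastCases with
                | last =>
                  simp only [Fin.append_left, Fin.snoc_last]
                  -- Bodies chosen for the inner arguments assemble into a body of the inner box, so
                  -- the hypothesis on `M` applies.
                  refine .box _ _ fun j => ?_
                  simpa using hK (Fin.castAdd _ (Fin.natAdd _ j))
                | cast i => simpa using hK (Fin.castAdd _ (Fin.castAdd _ i))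
              | right i => simpa using hK (Fin.natAdd _ i)
        | boxArg i hs =>
          refine ihS _ (cutExpand_update (hN i) hs) ?_ ?_ rfl
          · intro j
            rcases eq_or_ne j i with rfl | hj
            · rw [Function.update_self]
              exact (hN j).inv hs
            · rw [Function.update_of_ne hj]
              exact hN j
          · refine fun K hK => h K fun j => ?_
            have := hK j
            rcases eq_or_ne j i with rfl | hj
            · rw [Function.update_self] at this
              exact .step hs this
            · rwa [Function.update_of_ne hj] at this
        | boxBody hs => exact ihM _ hs fun K hK => (h K hK).step (hs.subst K)
      refine ⟨⟨_, fun T hT => (key T hT).1⟩, fun K hK => ?_⟩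
      cases hK with
      | var => exact .var τ
      | step hs hK => exact (key _ hs).2 _ hK
      | box _ _ hK => exact h _ hK

theorem HasType.reducible {n : ℕ} {Γ : Fin n → Ty P} {M : Term P C n} {τ : Ty P}
    (hM : HasType Γ M τ) : ∀ s : Fin n → Term P C 1, (∀ i, Reducible (Γ i) (s i)) →
      Reducible τ (M.subst s) := by
  induction hM with
  | const c τ => exact fun _ _ => .const c τ τ
  | var x => exact fun s hs => hs x
  | lam _ ih =>
    refine fun s hs => .lam fun N hN => ?_
    rw [inst_subst_lift]
    refine ih _ fun i => ?_
    cases i using Fin.cases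
    · exact hN
    · exact hs _
  | app _ _ ihM ihN => exact fun s hs => ihM s hs _ (ihN s hs)
  | box _ _ ihM ihN =>
    exact fun s hs => .box (fun i => (ihN i s hs).sn)
      fun K hK => ihM K fun i => (ihN i s hs).2 _ (hK i)

end Reducibility

theorem proposition2 {P : Type*} {C : Type*} {n : ℕ} (Γ : Fin n → Ty P) (M : Term P C n)
    (τ : Ty P) (hM : HasType Γ M τ) : StronglyNormalizing cbnRules M :=
  (hM.reducible (fun _ => .var 0) fun i => .var (Γ i)).sn.of_subst
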